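/- Let $N\ge 2$, let $F_1,\dots,F_N$ be contractive similitudes of $\mathbb{R}^n$ with similarity ratios $c_1,\dots,c_N\in(0,1)$, and let $K=\bigcup_{i=1}^N F_iK$ be their self-similar set (the nonempty compact invariant set). Assume that $K$ is connected and is not a single point. Put $c_*=\min_i c_i$, and for a finite word $w=w_1\cdots w_m$ over $\{1,\dots,N\}$ (possibly empty) put $F_w=F_{w_1}\circ\cdots\circ F_{w_m}$ and $c_w=c_{w_1}\cdots c_{w_m}$. $K$ has the *finite neighboring type property* if there are only finitely many similitudes $h=F_w^{-1}F_u$ with $w,u$ finite words, $F_wK\cap F_uK\ne\emptyset$, and similarity ratio of $h$ in $(c_*,1/c_*)$. An *overlapping chain* of length $m$ is a sequence of distinct copies $(F_{w^{(1)}}K,\dots,F_{w^{(m)}}K)$ such that $F_{w^{(i+1)}}K\cap\bigcup_{j\le i}F_{w^{(j)}}K$ is infinite for $1\le i\le m-1$, and $F_{w^{(i)}}K\not\subseteq F_{w^{(j)}}K$ for $i\ne j$. It is a *$\delta$-overlapping chain* ($0<\delta<1$) if moreover $\delta\le c_{w^{(i)}}c_{w^{(j)}}^{-1}\le 1/\delta$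 for all $i,j$. $K$ has the *finite chain length property* (resp. the *finite $\delta$-chain length property*) if the lengths of its overlapping chains (resp. $\delta$-overlapping chains) are bounded. A *nested structure* $\{K_\alpha,\Lambda_\alpha\}_{\alpha\in\Lambda}$ of $K$ consists of a countable family of distinct compact connected subsets $K_\alpha\subseteq K$, none of them a singleton, and finite sets $\Lambda_\alpha\subseteq\Lambda$ of *children* with $\#\Lambda_\alpha\ge2$ and $K_\alpha=\bigcup_{\beta\in\Lambda_\alpha}K_\beta$, together with a root $\vartheta\in\Lambda$ such that $K_\vartheta=K$ and every $\alpha\neq\vartheta$ is reached from $\vartheta$ by passing finitely many times to a child. Let $C_\alpha=\bigcup_{\beta\ne\beta'\in\Lambda_\alpha}K_\beta\cap K_{\beta'}$. The nested structure is *f.r.f.t.* (finitely ramified of finite type) if there are an equivalence relation $\sim$ on $\Lambda$ and similitudes $\phi_{\alpha,\beta}$ of $\mathbb{R}^n$ for $\alpha\sim\beta$, with $\phi_{\alpha,\beta}(K_\alpha)=K_\beta$, $\phi_{\alpha,\alpha}=\mathrm{id}$ and $\phi_{\gamma,\beta}\circ\phi_{\alpha,\gamma}=\phi_{\alpha,\beta}$,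 such that 1. $\Lambda/{\sim}$ is finite; 2. for $\alpha\sim\alpha'$ there is a bijection $\Lambda_\alpha\to\Lambda_{\alpha'}$ that sends each $\beta\in\Lambda_\alpha$ to the unique $\beta'\in\Lambda_{\alpha'}$ with $\beta\sim\beta'$ and $\phi_{\beta,\beta'}=\phi_{\alpha,\alpha'}$; 3. for every $\alpha\in\Lambda$ the set $V_\alpha=\bigcup_{\beta\sim\alpha,\ \beta\ne\vartheta}\phi_{\beta,\alpha}\bigl(K_\beta\cap\bigcup_{\gamma}C_\gamma\bigr)$ is finite, where $\gamma$ runs over all ancestors (parents, parents of parents, and so on) of $\beta$. **Theorem.** Suppose that $K$ has the finite neighboring type property. (i) If $K$ has the finite $\delta$-chain length property for some $0<\delta\le c_*$, then $K$ possesses an f.r.f.t. nested structure. (ii) If $K$ has the finite chain length property, then $K$ possesses an f.r.f.t. nested structure. -/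

import Mathlib

open scoped NNReal

/-- Euclidean space `ℝⁿ`. -/
abbrev Euc (n : ℕ) : Type := EuclideanSpace ℝ (Fin n)

/-- Similitudes of `ℝⁿ`. Every similitude of `ℝⁿ` is bijective, so these are the
self-dilation-equivalences; they form a group whose multiplication is composition. -/
abbrev Similitude (n : ℕ) : Type := Euc n ≃ᵈ Euc n

section SelfSimilar

variable {n N : ℕ}

/-- `K` is the self-similar set of the iterated function system `F` of `N ≥ 2`
contractive similitudes of `ℝⁿ`. -/
structure IsSelfSimilarSet (F : Fin N → Similitude n) (K : Set (Euc n)) : Prop where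
  two_le : 2 ≤ N
  contractive : ∀ i, Dilation.ratio (F i) < 1
  nonempty : K.Nonempty
  isCompact : IsCompact K
  self_similar : K = ⋃ i, F i '' K

/-- `F_w = F_{w₁} ∘ ⋯ ∘ F_{wₘ}` for a finite word `w = w₁ ⋯ wₘ` (the identity for the empty
word). -/
noncomputable def wordMap (F : Fin N → Similitude n) (w : List (Fin N)) : Similitude n :=
  (w.map F).prod

/-- The copy `F_w K` of `K`. -/
def cell (F : Fin N → Similitude n) (K : Set (Euc n)) (w : List (Fin N)) : Set (Euc n) :=
  wordMap F w '' K

/-- `c_w = c_{w₁} ⋯ c_{wₘ}`, where `c_i` is the similarity ratio of `F_i`. -/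
noncomputable def wordRatio (F : Fin N → Similitude n) (w : List (Fin N)) : ℝ≥0 :=
  (w.map fun i => Dilation.ratio (F i)).prod

/-- `c_* = min {c_1, …, c_N}`. -/
noncomputable def minRatio (F : Fin N → Similitude n) : ℝ≥0 :=
  ⨅ i, Dilation.ratio (F i)

/-- The finite neighboring type property. -/
def FiniteNeighboringType (F : Fin N → Similitude n) (K : Set (Euc n)) : Prop :=
  {h : Similitude n | ∃ w u : List (Fin N),
      h = (wordMap F w)⁻¹ * wordMap F u ∧
      (cell F K w ∩ cell F K u).Nonempty ∧
      minRatio F < Dilation.ratio h ∧ Dilation.ratio h < (minRatio F)⁻¹}.Finite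

/-- The words `γ 0, …, γ (m - 1)` give an overlapping chain of length `m`: every copy except the
first meets the union of the preceding ones in infinitely many points, and no copy is contained
in another one (in particular the copies are distinct). -/
structure IsOverlappingChain (F : Fin N → Similitude n) (K : Set (Euc n)) {m : ℕ}
    (γ : Fin m → List (Fin N)) : Prop where
  overlap : ∀ i : Fin m, 0 < i.val →
    (cell F K (γ i) ∩ ⋃ (j : Fin m) (_ : j < i), cell F K (γ j)).Infinite
  not_subset : ∀ i j : Fin m, i ≠ j → ¬ cell F K (γ i) ⊆ cell F K (γ j)

/-- A `δ`-overlapping chain: an overlapping chain of copies of comparable size. -/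
structure IsDeltaOverlappingChain (F : Fin N → Similitude n) (K : Set (Euc n)) (δ : ℝ≥0) {m : ℕ}
    (γ : Fin m → List (Fin N)) : Prop extends IsOverlappingChain F K γ where
  comparable : ∀ i j : Fin m,
    δ ≤ wordRatio F (γ i) * (wordRatio F (γ j))⁻¹ ∧
      wordRatio F (γ i) * (wordRatio F (γ j))⁻¹ ≤ 1 / δ

/-- `𝓛(K)`, the supremum of the lengths of overlapping chains. -/
noncomputable def chainLength (F : Fin N → Similitude n) (K : Set (Euc n)) : ℕ∞ :=
  sSup {l : ℕ∞ | ∃ (m : ℕ) (γ : Fin m → List (Fin N)), l = m ∧ IsOverlappingChain F K γ}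

/-- `𝓛_δ(K)`, the supremum of the lengths of `δ`-overlapping chains. -/
noncomputable def deltaChainLength (F : Fin N → Similitude n) (K : Set (Euc n)) (δ : ℝ≥0) : ℕ∞ :=
  sSup {l : ℕ∞ | ∃ (m : ℕ) (γ : Fin m → List (Fin N)),
    l = m ∧ IsDeltaOverlappingChain F K δ γ}

/-- The finite chain length property. -/
def FiniteChainLength (F : Fin N → Similitude n) (K : Set (Euc n)) : Prop :=
  chainLength F K < ⊤

/-- The finite `δ`-chain length property for the given `δ`. -/
def FiniteDeltaChainLength (F : Fin N → Similitude n) (K : Set (Euc n)) (δ : ℝ≥0) : Prop :=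
  deltaChainLength F K δ < ⊤

end SelfSimilar

/-- A nested structure `{K_α, Λ_α}_{α ∈ Λ}` of `K`. -/
structure NestedStructure {n : ℕ} (K : Set (Euc n)) (Λ : Type) where
  /-- the sets `K_α` -/
  island : Λ → Set (Euc n)
  /-- the finite sets `Λ_α` of children -/
  children : Λ → Finset Λ
  /-- the index `ϑ` -/
  root : Λ
  countable : Countable Λ
  island_injective : Function.Injective island
  island_subset : ∀ α, island α ⊆ K
  island_isCompact : ∀ α, IsCompact (island α)
  island_isConnected : ∀ α, IsConnected (island α)
  island_nontrivial : ∀ α, (island α).Nontrivial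
  island_root : island root = K
  two_le_card_children : ∀ α, 2 ≤ (children α).card
  island_eq_iUnion : ∀ α, island α = ⋃ β ∈ children α, island β
  offspring_root : ∀ α, α ≠ root → Relation.TransGen (fun a b => b ∈ children a) root α

namespace NestedStructure

variable {n : ℕ} {K : Set (Euc n)} {Λ : Type}

/-- `γ ∈ P^k(β)` for some `k ≥ 1`. -/
def IsAncestor (S : NestedStructure K Λ) (γ β : Λ) : Prop :=
  Relation.TransGen (fun a b => b ∈ S.children a) γ β

/-- `C_α`, the union of the intersections of distinct children of `K_α`. -/
def crossing (S : NestedStructure K Λ) (α : Λ) : Set (Euc n) :=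
  {x | ∃ β ∈ S.children α, ∃ β' ∈ S.children α, β ≠ β' ∧ x ∈ S.island β ∩ S.island β'}

/-- The division of the islands into types: `α ∼ β` means that a similitude `φ_{α,β}` of `K_α` onto
`K_β` has been fixed, the fixed similitudes being consistent under composition; so `∼` is the
equivalence relation induced by the choice of the similitudes. (In a graph-directed construction
these are the similitudes between pieces with the same state.) The values `φ α β` for inequivalent
`α, β` are irrelevant. -/
structure TypeSystem (S : NestedStructure K Λ) where
  /-- the equivalence relation `∼` -/
  rel : Setoid Λ
  /-- the similitudes `φ_{α,β}` -/
  φ : Λ → Λ → Similitude n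
  image_island : ∀ α β, rel α β → φ α β '' S.island α = S.island β
  φ_self : ∀ α, φ α α = 1
  φ_comp : ∀ α γ β, rel α γ → rel γ β → φ γ β * φ α γ = φ α β

/-- The boundary `V_α` of the island `K_α`. -/
def TypeSystem.boundary {S : NestedStructure K Λ} (T : S.TypeSystem) (α : Λ) : Set (Euc n) :=
  ⋃ (β : Λ) (_ : T.rel β α ∧ β ≠ S.root),
    T.φ β α '' (S.island β ∩ ⋃ (γ : Λ) (_ : S.IsAncestor γ β), S.crossing γ)

/-- The nested structure is finitely ramified of finite type: there are finitely many types,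
islands of the same type are split in the same way, and all boundaries are finite. -/
structure TypeSystem.IsFRFT {S : NestedStructure K Λ} (T : S.TypeSystem) : Prop where
  finite_types : Finite (Quotient T.rel)
  same_splitting : ∀ α α', T.rel α α' → ∃ e : S.children α ≃ S.children α',
    ∀ (β : S.children α) (β' : S.children α'),
      β' = e β ↔ (T.rel β β' ∧ T.φ β β' = T.φ α α')
  finite_boundary : ∀ α, (T.boundary α).Finite

end NestedStructure

/-- `K` possesses an f.r.f.t. nested structure. -/
def HasFRFTNestedStructure {n : ℕ} (K : Set (Euc n)) : Prop :=
  ∃ (Λ : Type) (S : NestedStructure K Λ) (T : S.TypeSystem), T.IsFRFT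

namespace SelfSimilar

open Set Relation
open scoped Pointwise

variable {n N : ℕ} {F : Fin N → Similitude n} {K : Set (Euc n)}

/-! Islands are unions of clusters: finite sets of maps `F_w` whose ratios differ by a factor less
than `1/c_*` and whose copies of `K` are linked through infinite intersections. Let `H` be the
finite set of neighbor maps, and let `L` bound the lengths of `c_*`-overlapping chains.

Rigidity (`IsCluster.inv_mul_mem_pow`): a greedy chain of maximal copies in a cluster stops after at
most `L` copies, and then every copy lies in one of them. Hence `A ⊆ f H^(L+2)` for each `f ∈ A`,
which leaves finitely many clusters up to similitude and bounds their diameter relative to their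
scale.

Splitting (`IsCluster.exists_isSplitting`): by that diameter bound, a fine enough refinement of a
cluster is not linked. Its components are at least two clusters whose unions meet pairwise in finite
sets; these are the children. The splitting is chosen on normalized clusters, so it depends only on
the type.

Boundary (`exists_mem_touchingPoints`): a boundary point of an island lies in one of its copies `bK`
and in a copy of about the same size that meets `bK` in a finite set. Up to `b`, only finitely many
such points exist. -/

theorem ratio_mul (f g : Similitude n) :
    Dilation.ratio (f * g) = Dilation.ratio f * Dilation.ratio g :=
  map_mul DilationEquiv.ratioHom f g

theorem ratio_one : Dilation.ratio (1 : Similitude n) = 1 :=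
  map_one DilationEquiv.ratioHom

theorem image_mul (f g : Similitude n) (s : Set (Euc n)) : (f * g) '' s = f '' (g '' s) := by
  rw [DilationEquiv.coe_mul, image_comp]

theorem image_inter (f : Similitude n) (s t : Set (Euc n)) : f '' (s ∩ t) = f '' s ∩ f '' t :=
  Set.image_inter f.injective

theorem infinite_image_iff (f : Similitude n) {s : Set (Euc n)} :
    (f '' s).Infinite ↔ s.Infinite :=
  Set.infinite_image_iff f.injective.injOn

theorem finite_image_iff (f : Similitude n) {s : Set (Euc n)} :
    (f '' s).Finite ↔ s.Finite :=
  Set.finite_image_iff f.injective.injOn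

/-! ### Words, ratios and cutting a copy to a given scale -/

theorem wordMap_nil : wordMap F [] = 1 := rfl

theorem wordMap_cons (i : Fin N) (w : List (Fin N)) : wordMap F (i :: w) = F i * wordMap F w := by
  simp [wordMap]

theorem wordMap_append (w v : List (Fin N)) :
    wordMap F (w ++ v) = wordMap F w * wordMap F v := by
  simp [wordMap]

theorem ratio_wordMap (w : List (Fin N)) : Dilation.ratio (wordMap F w) = wordRatio F w := by
  induction w with
  | nil => simp [wordMap_nil, ratio_one, wordRatio]
  | cons i w ih => rw [wordMap_cons, ratio_mul, ih]; simp [wordRatio]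

theorem wordRatio_cons (i : Fin N) (w : List (Fin N)) :
    wordRatio F (i :: w) = Dilation.ratio (F i) * wordRatio F w := by
  simp [wordRatio]

theorem minRatio_le (i : Fin N) : minRatio F ≤ Dilation.ratio (F i) :=
  ciInf_le (OrderBot.bddBelow _) i

theorem minRatio_pos (hK : IsSelfSimilarSet F K) : 0 < minRatio F := by
  have : Nonempty (Fin N) := ⟨⟨0, by have := hK.two_le; omega⟩⟩
  obtain ⟨i, hi⟩ := exists_eq_ciInf_of_finite (f := fun i => Dilation.ratio (F i))
  unfold minRatio
  rw [← hi]
  exact Dilation.ratio_pos _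

theorem minRatio_lt_one (hK : IsSelfSimilarSet F K) : minRatio F < 1 :=
  (minRatio_le ⟨0, by have := hK.two_le; omega⟩).trans_lt (hK.contractive _)

theorem exists_ratio_le (hK : IsSelfSimilarSet F K) :
    ∃ q : ℝ≥0, q < 1 ∧ ∀ i, Dilation.ratio (F i) ≤ q := by
  have : Nonempty (Fin N) := ⟨⟨0, by have := hK.two_le; omega⟩⟩
  obtain ⟨i, hi⟩ := Finite.exists_max (fun i => Dilation.ratio (F i))
  exact ⟨_, hK.contractive i, hi⟩

theorem wordRatio_le_one (hK : IsSelfSimilarSet F K) (w : List (Fin N)) : wordRatio F w ≤ 1 := by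
  induction w with
  | nil => simp [wordRatio]
  | cons i w ih => rw [wordRatio_cons]; exact mul_le_one' (hK.contractive i).le ih

theorem cell_nil : cell F K [] = K := by simp [cell, wordMap_nil]

theorem cell_cons (i : Fin N) (w : List (Fin N)) : cell F K (i :: w) = F i '' cell F K w := by
  rw [cell, wordMap_cons, image_mul, cell]

theorem cell_subset (hK : IsSelfSimilarSet F K) (w : List (Fin N)) : cell F K w ⊆ K := by
  induction w with
  | nil => rw [cell_nil]
  | cons i w ih =>
    rw [cell_cons]
    refine (image_mono ih).trans ?_
    conv_rhs => rw [hK.self_similar]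
    exact subset_iUnion (fun i => F i '' K) i

/-- A copy of ratio `r` is the union of finitely many subcopies of ratios in `(c_* s, s]`. -/
theorem exists_cut (hK : IsSelfSimilarSet F K) {s : ℝ≥0} (hs : 0 < s) {r : ℝ≥0}
    (hr : minRatio F * s < r) :
    ∃ T : Set (List (Fin N)), T.Finite ∧ K = ⋃ v ∈ T, cell F K v ∧
      ∀ v ∈ T, minRatio F * s < r * wordRatio F v ∧ r * wordRatio F v ≤ s := by
  obtain ⟨q, hq1, hq⟩ := exists_ratio_le hK
  -- All ratios are at most `q < 1`, so `k` subdivisions suffice once `r * q ^ k ≤ s`.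
  have key : ∀ (k : ℕ) (r : ℝ≥0), r * q ^ k ≤ s → minRatio F * s < r →
      ∃ T : Set (List (Fin N)), T.Finite ∧ K = ⋃ v ∈ T, cell F K v ∧
        ∀ v ∈ T, minRatio F * s < r * wordRatio F v ∧ r * wordRatio F v ≤ s := by
    intro k
    induction k with
    | zero =>
      intro r h1 h2
      exact ⟨{[]}, by simp, by simp [cell_nil], by simpa [wordRatio] using ⟨h2, by simpa using h1⟩⟩
    | succ k ih =>
      intro r h1 h2
      by_cases hrs : r ≤ s
      · exact ⟨{[]}, by simp, by simp [cell_nil], by simpa [wordRatio] using ⟨h2, hrs⟩⟩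
      push Not at hrs
      have : ∀ i : Fin N, ∃ T : Set (List (Fin N)), T.Finite ∧ K = ⋃ v ∈ T, cell F K v ∧
          ∀ v ∈ T, minRatio F * s < r * Dilation.ratio (F i) * wordRatio F v ∧
            r * Dilation.ratio (F i) * wordRatio F v ≤ s := by
        intro i
        refine ih _ (le_trans ?_ h1) ?_
        · rw [pow_succ', ← mul_assoc]
          gcongr
          exact hq i
        -- Only copies of ratio `r > s` are subdivided, which keeps the pieces above `c_* s`.
        · calc minRatio F * s < minRatio F * r := by
                have := minRatio_pos hK
                gcongr
            _ ≤ r * Dilation.ratio (F i) := by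
                rw [mul_comm]; gcongr; exact minRatio_le i
      choose T hT1 hT2 hT3 using this
      refine ⟨⋃ i, (List.cons i) '' T i, finite_iUnion fun i => (hT1 i).image _, ?_, ?_⟩
      · rw [biUnion_iUnion]
        conv_lhs => rw [hK.self_similar]
        refine iUnion_congr fun i => ?_
        conv_lhs => rw [hT2 i]
        rw [biUnion_image, image_iUnion₂]
        simp_rw [cell_cons]
      · simp only [mem_iUnion, mem_image]
        rintro _ ⟨i, v, hv, rfl⟩
        rw [wordRatio_cons, ← mul_assoc]
        exact hT3 i v hv
  by_cases h0 : r = 0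
  · simp [h0] at hr
  obtain ⟨k, hk⟩ := exists_pow_lt_of_lt_one (div_pos hs (pos_iff_ne_zero.2 h0)) hq1
  refine key k r ?_ hr
  rw [lt_div_iff₀ (pos_iff_ne_zero.2 h0)] at hk
  rw [mul_comm]
  exact hk.le

/-! ### Unions of copies and linking by infinite intersections -/

/-- The union of the copies of `K` under the similitudes in `A`. -/
def union (K : Set (Euc n)) (A : Set (Similitude n)) : Set (Euc n) := ⋃ a ∈ A, a '' K

theorem mem_union {A : Set (Similitude n)} {x : Euc n} :
    x ∈ union K A ↔ ∃ a ∈ A, x ∈ a '' K := by simp [union]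

theorem image_subset_union {A : Set (Similitude n)} {a : Similitude n} (ha : a ∈ A) :
    a '' K ⊆ union K A := fun _ hx => mem_union.2 ⟨a, ha, hx⟩

theorem union_smul (g : Similitude n) (A : Set (Similitude n)) :
    union K (g • A) = g '' union K A := by
  rw [union, union, image_iUnion₂, ← Set.image_smul, biUnion_image]
  simp_rw [smul_eq_mul, image_mul]

/-- Two similitudes in `A` are adjacent if the corresponding copies have infinite intersection. -/
def Step (K : Set (Euc n)) (A : Set (Similitude n)) (a b : Similitude n) : Prop :=
  a ∈ A ∧ b ∈ A ∧ (a '' K ∩ b '' K).Infinite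

theorem Step.symm {A : Set (Similitude n)} {a b : Similitude n} (h : Step K A a b) :
    Step K A b a := ⟨h.2.1, h.1, by rw [inter_comm]; exact h.2.2⟩

/-- Any two members of `A` are linked by a sequence of copies with infinite consecutive
intersections. -/
def Linked (K : Set (Euc n)) (A : Set (Similitude n)) : Prop :=
  ∀ a ∈ A, ∀ b ∈ A, ReflTransGen (Step K A) a b

theorem Step.smul (g : Similitude n) {A : Set (Similitude n)} {a b : Similitude n}
    (h : Step K A a b) : Step K (g • A) (g • a) (g • b) := by
  refine ⟨smul_mem_smul_set h.1, smul_mem_smul_set h.2.1, ?_⟩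
  rw [smul_eq_mul, smul_eq_mul, image_mul, image_mul, ← image_inter, infinite_image_iff]
  exact h.2.2

theorem Linked.smul (g : Similitude n) {A : Set (Similitude n)} (h : Linked K A) :
    Linked K (g • A) := by
  rintro _ ⟨a, ha, rfl⟩ _ ⟨b, hb, rfl⟩
  exact ReflTransGen.lift (g • ·) (fun _ _ hs => Step.smul g hs) _ _ (h a ha b hb)

/-- The component of `a` in `A` under adjacency. -/
def component (K : Set (Euc n)) (A : Set (Similitude n)) (a : Similitude n) :
    Set (Similitude n) := {b | b ∈ A ∧ ReflTransGen (Step K A) a b}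

theorem reflTransGen_step_symm {A : Set (Similitude n)} {a b : Similitude n}
    (h : ReflTransGen (Step K A) a b) : ReflTransGen (Step K A) b a := by
  induction h with
  | refl => exact .refl
  | tail _ h2 ih => exact .head h2.symm ih

/-- Every member visited by a path from `a` is itself in the component, so the path never leaves it.
-/
theorem linked_component {A : Set (Similitude n)} {a : Similitude n} :
    Linked K (component K A a) := by
  have key : ∀ b, ReflTransGen (Step K A) a b → ReflTransGen (Step K (component K A a)) a b := by
    intro b hb
    induction hb with
    | refl => exact .refl
    | tail h1 h2 ih => exact ih.tail ⟨⟨h2.1, h1⟩, ⟨h2.2.1, h1.tail h2⟩, h2.2.2⟩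
  intro b hb d hd
  exact (reflTransGen_step_symm (key b hb.2)).trans (key d hd.2)

theorem component_eq {A : Set (Similitude n)} {a b : Similitude n}
    (h : ReflTransGen (Step K A) a b) : component K A a = component K A b := by
  ext d
  exact and_congr_right fun _ => ⟨fun h' => (reflTransGen_step_symm h).trans h', h.trans⟩

theorem finite_inter_union {A B : Set (Similitude n)} (hA : A.Finite) (hB : B.Finite)
    (h : ∀ a ∈ A, ∀ b ∈ B, (a '' K ∩ b '' K).Finite) : (union K A ∩ union K B).Finite := by
  have : union K A ∩ union K B ⊆ ⋃ a ∈ A, ⋃ b ∈ B, a '' K ∩ b '' K := by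
    rintro x ⟨h1, h2⟩
    obtain ⟨a, ha, hxa⟩ := mem_union.1 h1
    obtain ⟨b, hb, hxb⟩ := mem_union.1 h2
    exact mem_biUnion ha (mem_biUnion hb ⟨hxa, hxb⟩)
  exact (hA.biUnion fun a ha => hB.biUnion fun b hb => h a ha b hb).subset this

theorem isCompact_image (hK : IsCompact K) (f : Similitude n) : IsCompact (f '' K) :=
  hK.image (Dilation.toContinuous f)

theorem isConnected_image (hK : IsConnected K) (f : Similitude n) : IsConnected (f '' K) :=
  hK.image f (Dilation.toContinuous f).continuousOn

theorem isCompact_union (hK : IsCompact K) {A : Set (Similitude n)} (hA : A.Finite) :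
    IsCompact (union K A) := hA.isCompact_biUnion fun a _ => isCompact_image hK a

theorem isConnected_union (hK : IsConnected K) {A : Set (Similitude n)} (hA : A.Nonempty)
    (h : Linked K A) : IsConnected (union K A) :=
  IsConnected.biUnion_of_reflTransGen hA (fun a _ => isConnected_image hK a) fun a ha b hb =>
    ReflTransGen.mono (fun _ _ hs => ⟨hs.2.2.nonempty, hs.1⟩) _ _ (h a ha b hb)

theorem nontrivial_union (hK : K.Nontrivial) {A : Set (Similitude n)} (hA : A.Nonempty) :
    (union K A).Nontrivial := by
  obtain ⟨a, ha⟩ := hA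
  exact (hK.image a.injective).mono (image_subset_union ha)

theorem infinite_union (hK : IsConnected K) (hnt : K.Nontrivial) {A : Set (Similitude n)}
    (hA : A.Nonempty) : (union K A).Infinite := by
  obtain ⟨a, ha⟩ := hA
  exact ((infinite_image_iff a).2 (hK.isPreconnected.infinite_of_nontrivial hnt)).mono
    (image_subset_union ha)

/-! ### Neighbor maps and clusters -/

/-- The relative positions `F_w⁻¹ F_u` of intersecting copies of comparable size. -/
def neighborMaps (F : Fin N → Similitude n) (K : Set (Euc n)) : Set (Similitude n) :=
  {h | ∃ w u : List (Fin N), h = (wordMap F w)⁻¹ * wordMap F u ∧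
      (cell F K w ∩ cell F K u).Nonempty ∧
      minRatio F < Dilation.ratio h ∧ Dilation.ratio h < (minRatio F)⁻¹}

theorem mem_neighborMaps (hK : IsSelfSimilarSet F K) {a b : Similitude n}
    (ha : a ∈ range (wordMap F)) (hb : b ∈ range (wordMap F)) (hab : (a '' K ∩ b '' K).Nonempty)
    (h1 : minRatio F * Dilation.ratio a < Dilation.ratio b)
    (h2 : minRatio F * Dilation.ratio b < Dilation.ratio a) : a⁻¹ * b ∈ neighborMaps F K := by
  obtain ⟨w, rfl⟩ := ha
  obtain ⟨u, rfl⟩ := hb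
  refine ⟨w, u, rfl, hab, ?_, ?_⟩
  · rw [ratio_mul, DilationEquiv.ratio_inv, lt_inv_mul_iff₀ (Dilation.ratio_pos _), mul_comm]
    exact h1
  · rw [ratio_mul, DilationEquiv.ratio_inv, inv_mul_lt_iff₀ (Dilation.ratio_pos _),
      ← div_eq_mul_inv, lt_div_iff₀ (minRatio_pos hK), mul_comm]
    exact h2

/-- This makes the powers of `neighborMaps F K` increasing in the exponent. -/
theorem one_mem_neighborMaps (hK : IsSelfSimilarSet F K) : 1 ∈ neighborMaps F K := by
  have h := mem_neighborMaps (a := 1) (b := 1) hK ⟨[], rfl⟩ ⟨[], rfl⟩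
    (by simpa using hK.nonempty) (by simpa [ratio_one] using minRatio_lt_one hK)
    (by simpa [ratio_one] using minRatio_lt_one hK)
  simpa using h

/-- A finite set of copies of comparable size, linked by infinite intersections. -/
structure IsCluster (F : Fin N → Similitude n) (K : Set (Euc n)) (A : Set (Similitude n)) :
    Prop where
  finite : A.Finite
  nonempty : A.Nonempty
  subset_range : A ⊆ range (wordMap F)
  linked : Linked K A
  ratio_lt : ∀ a ∈ A, ∀ b ∈ A, minRatio F * Dilation.ratio a < Dilation.ratio b

theorem IsCluster.inv_mul_mem {A : Set (Similitude n)} (hK : IsSelfSimilarSet F K)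
    (hA : IsCluster F K A) {a b : Similitude n} (ha : a ∈ A) (hb : b ∈ A)
    (hab : (a '' K ∩ b '' K).Nonempty) : a⁻¹ * b ∈ neighborMaps F K :=
  mem_neighborMaps hK (hA.subset_range ha) (hA.subset_range hb) hab (hA.ratio_lt a ha b hb)
    (hA.ratio_lt b hb a ha)

theorem Linked.exists_step {A : Set (Similitude n)} (hA : Linked K A) {a b : Similitude n}
    (ha : a ∈ A) (hb : b ∈ A) {p : Similitude n → Prop} (hpa : p a) (hpb : ¬ p b) :
    ∃ x y, p x ∧ ¬ p y ∧ Step K A x y := by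
  have h := hA a ha b hb
  induction h with
  | refl => exact absurd hpa hpb
  | @tail x y h1 h2 ih =>
    by_cases hx : p x
    · exact ⟨x, y, hx, hpb, h2⟩
    · exact ih h2.1 hx

/-! ### Maximal chains and the rigidity of clusters -/

/-- The copy `a K` is not properly contained in another copy from `A`. -/
def IsMaximalCopy (K : Set (Euc n)) (A : Set (Similitude n)) (a : Similitude n) : Prop :=
  a ∈ A ∧ ∀ b ∈ A, a '' K ⊆ b '' K → b '' K ⊆ a '' K

theorem exists_isMaximalCopy {A : Set (Similitude n)} (hA : A.Finite) {a : Similitude n}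
    (ha : a ∈ A) : ∃ b, IsMaximalCopy K A b ∧ a '' K ⊆ b '' K := by
  have hfin : {b | b ∈ A ∧ a '' K ⊆ b '' K}.Finite := hA.subset fun b hb => hb.1
  obtain ⟨b, hb, hmax⟩ := hfin.exists_maximalFor (fun b : Similitude n => b '' K) _
    ⟨a, ha, Subset.rfl⟩
  exact ⟨b, ⟨hb.1, fun d hd hbd => hmax ⟨hd, hb.2.trans hbd⟩ hbd⟩, hb.2⟩

/-- An overlapping chain of `m + 1` maximal copies in `A`, starting with `f₀`, in which the
`i`-th copy is reached from the first one by `i` neighbor maps. -/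
structure IsMaximalChain (F : Fin N → Similitude n) (K : Set (Euc n)) (A : Set (Similitude n))
    (f₀ : Similitude n) (m : ℕ) (γ : ℕ → Similitude n) : Prop where
  zero : γ 0 = f₀
  maximal : ∀ i ≤ m, IsMaximalCopy K A (γ i)
  mem_pow : ∀ i ≤ m, f₀⁻¹ * γ i ∈ neighborMaps F K ^ i
  overlap : ∀ i ≤ m, 0 < i → ∃ j < i, (γ i '' K ∩ γ j '' K).Infinite
  not_subset : ∀ i ≤ m, ∀ j ≤ m, i ≠ j → ¬ γ i '' K ⊆ γ j '' K

theorem IsMaximalChain.succ_le (hK : IsSelfSimilarSet F K) {A : Set (Similitude n)} {f₀ : Similitude n} {m L : ℕ}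
    {γ : ℕ → Similitude n} (hA : IsCluster F K A)
    (hL : ∀ (m : ℕ) (γ : Fin m → List (Fin N)),
      IsDeltaOverlappingChain F K (minRatio F) γ → m ≤ L)
    (hγ : IsMaximalChain F K A f₀ m γ) : m + 1 ≤ L := by
  have hmem : ∀ i : Fin (m + 1), γ i ∈ A := fun i => (hγ.maximal i (by omega)).1
  choose w hw using fun i : Fin (m + 1) => hA.subset_range (hmem i)
  have hcell : ∀ i, cell F K (w i) = γ i '' K := fun i => by rw [cell, hw]
  have hpos : ∀ i, 0 < wordRatio F (w i) := fun i => by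
    rw [← ratio_wordMap]; exact Dilation.ratio_pos _
  have hlt : ∀ i j, minRatio F * wordRatio F (w i) < wordRatio F (w j) := fun i j => by
    rw [← ratio_wordMap, ← ratio_wordMap, hw, hw]
    exact hA.ratio_lt _ (hmem i) _ (hmem j)
  refine hL (m + 1) w ⟨⟨fun i hi => ?_, fun i j hij => ?_⟩, fun i j => ⟨?_, ?_⟩⟩
  · obtain ⟨j, hj, hinf⟩ := hγ.overlap i (by omega) hi
    refine hinf.mono ?_
    rw [hcell]
    refine inter_subset_inter_right _ ?_
    rw [← hcell ⟨j, by omega⟩]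
    exact subset_iUnion₂ (s := fun (j : Fin (m + 1)) (_ : j < i) => cell F K (w j))
      ⟨j, by omega⟩ hj
  · rw [hcell, hcell]
    exact hγ.not_subset i (by omega) j (by omega) fun h => hij (Fin.ext h)
  · rw [← div_eq_mul_inv, le_div_iff₀ (hpos j)]
    exact (hlt j i).le
  · rw [← div_eq_mul_inv, div_le_div_iff₀ (hpos j) (minRatio_pos hK), one_mul, mul_comm]
    exact (hlt i j).le

/-- A path in `A` from `f₀` to the uncovered `a` crosses from a copy inside some `γ i` to a copy
inside no `γ j`. A maximal copy `b` containing the latter meets `γ i` infinitely often and lies in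
no `γ j`; maximality of `γ j` then keeps it from lying in `b`. -/
theorem IsMaximalChain.extend (hK : IsSelfSimilarSet F K) {A : Set (Similitude n)}
    {f₀ : Similitude n} {m : ℕ}
    {γ : ℕ → Similitude n} (hA : IsCluster F K A) (hγ : IsMaximalChain F K A f₀ m γ)
    {a : Similitude n} (ha : a ∈ A) (hna : ∀ i ≤ m, ¬ a '' K ⊆ γ i '' K) :
    ∃ γ', IsMaximalChain F K A f₀ (m + 1) γ' := by
  have h0 : f₀ ∈ A := by rw [← hγ.zero]; exact (hγ.maximal 0 (by omega)).1
  obtain ⟨x, y, ⟨i, hi, hxi⟩, hy, hx, hyA, hinf⟩ := hA.linked.exists_step h0 ha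
    (p := fun x => ∃ i ≤ m, x '' K ⊆ γ i '' K) ⟨0, by omega, by rw [hγ.zero]⟩
    (by push Not; exact hna)
  push Not at hy
  obtain ⟨b, hb, hyb⟩ := exists_isMaximalCopy (K := K) hA.finite hyA
  have hbn : ∀ j ≤ m, ¬ b '' K ⊆ γ j '' K := fun j hj h => hy j hj (hyb.trans h)
  have hbi : (b '' K ∩ γ i '' K).Infinite := by
    refine hinf.mono ?_
    rw [inter_comm]
    exact inter_subset_inter hyb hxi
  have hlt : ∀ j ≤ m, Function.update γ (m + 1) b j = γ j := fun j hj =>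
    Function.update_of_ne (by omega) _ _
  have hself : Function.update γ (m + 1) b (m + 1) = b := Function.update_self ..
  -- `b` is one step from `γ i`, hence `i + 1 ≤ m + 1` steps from `f₀`.
  have hbH : f₀⁻¹ * b ∈ neighborMaps F K ^ (m + 1) := by
    have h1 := hA.inv_mul_mem hK (hγ.maximal i hi).1 hb.1 (by rw [inter_comm]; exact hbi.nonempty)
    have h2 := Set.mul_mem_mul (hγ.mem_pow i hi) h1
    rw [← pow_succ, mul_assoc, mul_inv_cancel_left] at h2
    exact Set.pow_subset_pow_right (one_mem_neighborMaps hK) (by omega) h2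
  refine ⟨Function.update γ (m + 1) b, ⟨by rw [hlt 0 (by omega), hγ.zero], ?_, ?_, ?_, ?_⟩⟩
  · intro j hj
    rcases Nat.le_succ_iff.1 hj with hj | rfl
    · rw [hlt j hj]; exact hγ.maximal j hj
    · rw [hself]; exact hb
  · intro j hj
    rcases Nat.le_succ_iff.1 hj with hj | rfl
    · rw [hlt j hj]; exact hγ.mem_pow j hj
    · rw [hself]; exact hbH
  · intro j hj hj0
    rcases Nat.le_succ_iff.1 hj with hj | rfl
    · obtain ⟨k, hk, h⟩ := hγ.overlap j hj hj0
      exact ⟨k, hk, by rw [hlt j hj, hlt k (by omega)]; exact h⟩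
    · exact ⟨i, by omega, by rw [hself, hlt i hi]; exact hbi⟩
  · intro j hj k hk hjk
    rcases Nat.le_succ_iff.1 hj with hj | rfl <;> rcases Nat.le_succ_iff.1 hk with hk | rfl
    · rw [hlt j hj, hlt k hk]; exact hγ.not_subset j hj k hk hjk
    · rw [hlt j hj, hself]
      exact fun h => hbn j hj ((hγ.maximal j hj).2 b hb.1 h)
    · rw [hlt k hk, hself]
      exact hbn k hk
    · exact absurd rfl hjk

/-- If the lengths of chains are at most `L`, a cluster lies within `L + 2` neighbor steps of each
of its members. -/
theorem IsCluster.inv_mul_mem_pow (hK : IsSelfSimilarSet F K) {A : Set (Similitude n)} {L : ℕ}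
    (hA : IsCluster F K A)
    (hL : ∀ (m : ℕ) (γ : Fin m → List (Fin N)),
      IsDeltaOverlappingChain F K (minRatio F) γ → m ≤ L)
    {f a : Similitude n} (hf : f ∈ A) (ha : a ∈ A) : f⁻¹ * a ∈ neighborMaps F K ^ (L + 2) := by
  have himg : ∀ g : Similitude n, (g '' K).Nonempty := fun g => hK.nonempty.image g
  obtain ⟨f₀, hf₀, hff₀⟩ := exists_isMaximalCopy (K := K) hA.finite hf
  have hstep : ∃ m γ, IsMaximalChain F K A f₀ m γ ∧
      ∀ x ∈ A, ∃ i ≤ m, x '' K ⊆ γ i '' K := by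
    by_contra hcon
    push Not at hcon
    have hall : ∀ m, ∃ γ, IsMaximalChain F K A f₀ m γ := by
      intro m
      induction m with
      | zero =>
        refine ⟨fun _ => f₀, rfl, fun _ _ => hf₀, fun i hi => ?_, fun i hi h => by omega,
          fun i hi j hj h => by omega⟩
        obtain rfl : i = 0 := by omega
        simp
      | succ m ih =>
        obtain ⟨γ, hγ⟩ := ih
        obtain ⟨x, hx, hxn⟩ := hcon m γ hγ
        exact hγ.extend hK hA hx hxn
    -- This chain has `L + 1` copies, one more than allowed.
    obtain ⟨γ, hγ⟩ := hall L
    have := hγ.succ_le hK hA hL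
    omega
  obtain ⟨m, γ, hγ, hcov⟩ := hstep
  have hm := hγ.succ_le hK hA hL
  obtain ⟨i, hi, hai⟩ := hcov a ha
  -- One step from `f` up to `f₀`, `i` steps to `γ i`, one step down to `a`: in all `i + 2 ≤ L + 1`.
  have h1 : f⁻¹ * f₀ ∈ neighborMaps F K :=
    hA.inv_mul_mem hK hf hf₀.1 (by rw [inter_eq_left.2 hff₀]; exact himg f)
  have h2 : (γ i)⁻¹ * a ∈ neighborMaps F K :=
    hA.inv_mul_mem hK (hγ.maximal i hi).1 ha (by rw [inter_eq_right.2 hai]; exact himg a)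
  have h3 := Set.mul_mem_mul (Set.mul_mem_mul h1 (hγ.mem_pow i hi)) h2
  rw [← pow_succ', ← pow_succ] at h3
  have h4 : f⁻¹ * f₀ * (f₀⁻¹ * γ i) * ((γ i)⁻¹ * a) = f⁻¹ * a := by group
  rw [h4] at h3
  exact Set.pow_subset_pow_right (one_mem_neighborMaps hK) (by omega) h3

/-! ### Splitting a cluster into smaller clusters -/

/-- A set of similitudes with a distinguished member. -/
abbrev Node (n : ℕ) : Type := Set (Similitude n) × Similitude n

/-- `C` is a partition of a refinement of the cluster `A` into at least two clusters whose unions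
have finite intersections, refined to a common scale. -/
structure IsSplitting (F : Fin N → Similitude n) (K : Set (Euc n)) (A : Set (Similitude n))
    (C : Set (Node n)) : Prop where
  finite : C.Finite
  nontrivial : C.Nontrivial
  mark_mem : ∀ x ∈ C, x.2 ∈ x.1
  finite_fst : ∀ x ∈ C, x.1.Finite
  linked : ∀ x ∈ C, Linked K x.1
  exists_eq_mul : ∀ x ∈ C, ∀ b ∈ x.1, ∃ a ∈ A, ∃ v, b = a * wordMap F v
  union_eq : union K A = ⋃ x ∈ C, union K x.1
  finite_inter : ∀ x ∈ C, ∀ y ∈ C, x ≠ y → (union K x.1 ∩ union K y.1).Finite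
  scale : ∃ s : ℝ≥0, ∀ x ∈ C, ∀ b ∈ x.1,
    minRatio F * s < Dilation.ratio b ∧ Dilation.ratio b ≤ s

theorem IsSplitting.smul {A : Set (Similitude n)} {C : Set (Node n)} (h : IsSplitting F K A C)
    (g : Similitude n) : IsSplitting F K (g • A) (g • C) where
  finite := h.finite.smul_set
  nontrivial := h.nontrivial.image (MulAction.injective g)
  mark_mem := by
    rintro _ ⟨x, hx, rfl⟩
    exact smul_mem_smul_set (h.mark_mem x hx)
  finite_fst := by
    rintro _ ⟨x, hx, rfl⟩
    exact (h.finite_fst x hx).smul_set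
  linked := by
    rintro _ ⟨x, hx, rfl⟩
    exact (h.linked x hx).smul g
  exists_eq_mul := by
    rintro _ ⟨x, hx, rfl⟩ _ ⟨b, hb, rfl⟩
    obtain ⟨a, ha, v, rfl⟩ := h.exists_eq_mul x hx b hb
    exact ⟨g • a, smul_mem_smul_set ha, v, (mul_assoc _ _ _).symm⟩
  union_eq := by
    rw [union_smul, h.union_eq, image_iUnion₂, ← Set.image_smul, biUnion_image]
    simp_rw [Prod.smul_fst, union_smul]
  finite_inter := by
    rintro _ ⟨x, hx, rfl⟩ _ ⟨y, hy, rfl⟩ hxy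
    have := h.finite_inter x hx y hy fun h => hxy (by rw [h])
    simp only [Prod.smul_fst, union_smul]
    rw [← image_inter]
    exact this.image _
  scale := by
    obtain ⟨s, hs⟩ := h.scale
    refine ⟨Dilation.ratio g * s, ?_⟩
    rintro _ ⟨x, hx, rfl⟩ _ ⟨b, hb, rfl⟩
    simp only [smul_eq_mul, ratio_mul]
    have hg := Dilation.ratio_pos g
    obtain ⟨h1, h2⟩ := hs x hx b hb
    refine ⟨?_, by gcongr⟩
    rw [mul_left_comm]
    gcongr

theorem exists_refinement (hK : IsSelfSimilarSet F K) {A : Set (Similitude n)}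
    (hA : A.Finite) {s : ℝ≥0} (hs : 0 < s) (hsA : ∀ a ∈ A, minRatio F * s < Dilation.ratio a) :
    ∃ D : Set (Similitude n), D.Finite ∧ union K A = union K D ∧
      (∀ b ∈ D, ∃ a ∈ A, ∃ v, b = a * wordMap F v) ∧
      ∀ b ∈ D, minRatio F * s < Dilation.ratio b ∧ Dilation.ratio b ≤ s := by
  choose! T hT1 hT2 hT3 using fun a (ha : a ∈ A) => exists_cut hK hs (hsA a ha)
  refine ⟨⋃ a ∈ A, (fun v => a * wordMap F v) '' T a, hA.biUnion fun a ha => (hT1 a ha).image _,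
    ?_, ?_, ?_⟩
  · ext x
    simp only [mem_union, mem_iUnion, mem_image (f := fun v => _ * wordMap F v), exists_prop]
    constructor
    · rintro ⟨a, ha, y, hy, rfl⟩
      rw [hT2 a ha] at hy
      obtain ⟨v, hv, hy⟩ := mem_iUnion₂.1 hy
      exact ⟨_, ⟨a, ha, v, hv, rfl⟩, by rw [image_mul]; exact mem_image_of_mem _ hy⟩
    · rintro ⟨_, ⟨a, ha, v, hv, rfl⟩, hx⟩
      rw [image_mul] at hx
      exact ⟨a, ha, image_mono (cell_subset hK v) hx⟩
  · simp only [mem_iUnion, mem_image, exists_prop]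
    rintro _ ⟨a, ha, v, hv, rfl⟩
    exact ⟨a, ha, v, rfl⟩
  · simp only [mem_iUnion, mem_image, exists_prop]
    rintro _ ⟨a, ha, v, hv, rfl⟩
    rw [ratio_mul, ratio_wordMap]
    exact hT3 a ha v hv

theorem mul_wordMap_mem_range {a : Similitude n} (ha : a ∈ range (wordMap F))
    (v : List (Fin N)) : a * wordMap F v ∈ range (wordMap F) := by
  obtain ⟨w, rfl⟩ := ha
  exact ⟨w ++ v, wordMap_append w v⟩

/-- The half-open window `(c_* s, s]` for the ratios gives the strict comparability required of a
cluster. -/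
theorem IsCluster.of_isSplitting {A : Set (Similitude n)} {C : Set (Node n)}
    (hA : IsCluster F K A) (hC : IsSplitting F K A C) {x : Node n} (hx : x ∈ C) :
    IsCluster F K x.1 where
  finite := hC.finite_fst x hx
  nonempty := ⟨_, hC.mark_mem x hx⟩
  subset_range b hb := by
    obtain ⟨a, ha, v, rfl⟩ := hC.exists_eq_mul x hx b hb
    exact mul_wordMap_mem_range (hA.subset_range ha) v
  linked := hC.linked x hx
  ratio_lt a ha b hb := by
    obtain ⟨s, hs⟩ := hC.scale
    refine lt_of_le_of_lt ?_ (hs x hx b hb).1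
    gcongr
    exact (hs x hx a ha).2

theorem finite_pow {H : Set (Similitude n)} (hH : H.Finite) (k : ℕ) : (H ^ k).Finite := by
  induction k with
  | zero => simp
  | succ k ih => rw [pow_succ]; exact ih.mul hH

/-- A sufficiently fine refinement of a cluster falls apart. -/
theorem IsCluster.exists_isSplitting (hK : IsSelfSimilarSet F K) (hnt : K.Nontrivial)
    (hH : (neighborMaps F K).Finite) {A : Set (Similitude n)} {L : ℕ} (hA : IsCluster F K A)
    (hL : ∀ (m : ℕ) (γ : Fin m → List (Fin N)),
      IsDeltaOverlappingChain F K (minRatio F) γ → m ≤ L) :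
    ∃ C, IsSplitting F K A C := by
  set U := union K (neighborMaps F K ^ (L + 2)) with hU
  have hbdd : Bornology.IsBounded (union K A) := (isCompact_union hK.isCompact hA.finite).isBounded
  have hUb : Bornology.IsBounded U := (isCompact_union hK.isCompact (finite_pow hH _)).isBounded
  have hpos : 0 < Metric.diam (union K A) := by
    obtain ⟨x, hx, y, hy, hxy⟩ := nontrivial_union hnt hA.nonempty
    exact (dist_pos.2 hxy).trans_le (Metric.dist_le_diam_of_mem hbdd hx hy)
  obtain ⟨f, hf⟩ := hA.nonempty
  have hc := minRatio_pos hK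
  -- The second bound puts `s` below every ratio in `A`, so that `A` can be refined to scale `s`.
  -- The third leaves a linked refinement too small to cover `union K A`; the `+ 1` below avoids
  -- division by zero and makes it strict.
  obtain ⟨s, hs0, hsA, hsU⟩ : ∃ s : ℝ≥0, 0 < s ∧ s ≤ minRatio F * Dilation.ratio f ∧
      s * Metric.diam U < Metric.diam (union K A) := by
    have hd : 0 ≤ Metric.diam U := Metric.diam_nonneg
    set t : ℝ≥0 := ⟨Metric.diam (union K A) / (Metric.diam U + 1), by positivity⟩ with ht
    have ht0 : 0 < t := by
      rw [← NNReal.coe_pos, ht]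
      change 0 < Metric.diam (union K A) / (Metric.diam U + 1)
      positivity
    refine ⟨min t (minRatio F * Dilation.ratio f),
      lt_min ht0 (mul_pos hc (Dilation.ratio_pos f)), min_le_right _ _, ?_⟩
    calc ((min t (minRatio F * Dilation.ratio f) : ℝ≥0) : ℝ) * Metric.diam U
        ≤ t * Metric.diam U := by gcongr; exact min_le_left _ _
      _ < t * (Metric.diam U + 1) := by
          have : (0 : ℝ) < t := ht0
          nlinarith
      _ = Metric.diam (union K A) := by
          rw [ht]
          change Metric.diam (union K A) / (Metric.diam U + 1) * (Metric.diam U + 1) = _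
          field_simp
  have hsA' : ∀ a ∈ A, minRatio F * s < Dilation.ratio a := fun a ha => by
    calc minRatio F * s ≤ 1 * s := by gcongr; exact (minRatio_lt_one hK).le
      _ = s := one_mul s
      _ ≤ _ := hsA
      _ < _ := hA.ratio_lt f hf a ha
  obtain ⟨D, hDfin, hDU, hDmul, hDs⟩ := exists_refinement hK hA.finite hs0 hsA'
  have hDne : D.Nonempty := by
    by_contra h
    rw [not_nonempty_iff_eq_empty] at h
    rw [hDU, h] at hpos
    simp [union] at hpos
  -- If `D` were linked it would be a cluster, so rigidity would place its union in a copy `d '' U`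
  -- of diameter at most `s * diam U`, less than the diameter of that union.
  have hDnot : ¬ Linked K D := by
    intro hlink
    have hD : IsCluster F K D :=
      { finite := hDfin
        nonempty := hDne
        subset_range := fun b hb => by
          obtain ⟨a, ha, v, rfl⟩ := hDmul b hb
          exact mul_wordMap_mem_range (hA.subset_range ha) v
        linked := hlink
        ratio_lt := fun a ha b hb => by
          refine lt_of_le_of_lt ?_ (hDs b hb).1
          gcongr
          exact (hDs a ha).2 }
    obtain ⟨d, hd⟩ := hDne
    have hsub : union K D ⊆ d '' U := by
      rw [hU, ← union_smul]
      refine biUnion_subset_biUnion_left fun a ha => ?_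
      rw [Set.mem_smul_set_iff_inv_smul_mem]
      exact hD.inv_mul_mem_pow hK hL hd ha
    have h1 : Metric.diam (union K D) ≤ Dilation.ratio d * Metric.diam U := by
      rw [← Dilation.diam_image d U]
      exact Metric.diam_mono hsub ((Dilation.lipschitz d).isBounded_image hUb)
    have h2 : (Dilation.ratio d : ℝ) * Metric.diam U ≤ s * Metric.diam U := by
      gcongr
      exact (hDs d hd).2
    rw [hDU] at hsU
    linarith
  have hcomp : ∀ d ∈ D, d ∈ component K D d := fun d hd => ⟨hd, .refl⟩
  have hsubc : ∀ d, component K D d ⊆ D := fun d b hb => hb.1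
  have hmk : ∀ B ∈ component K D '' D, B.Nonempty := by
    rintro _ ⟨d, hd, rfl⟩
    exact ⟨d, hcomp d hd⟩
  -- The mark is a function of the component as a set, so distinct nodes have distinct components.
  choose! mark hmark using hmk
  refine ⟨(fun B => (B, mark B)) '' (component K D '' D), ?_⟩
  refine ⟨(hDfin.image _).image _, ?_, ?_, ?_, ?_, ?_, ?_, ?_, ?_⟩
  · refine Set.Nontrivial.image ?_ fun B B' h => congrArg Prod.fst h
    rw [← Set.not_subsingleton_iff]
    intro hsub
    refine hDnot fun a ha b hb => ?_
    have : b ∈ component K D a := by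
      rw [hsub ⟨a, ha, rfl⟩ ⟨b, hb, rfl⟩]
      exact hcomp b hb
    exact this.2
  · rintro _ ⟨B, hB, rfl⟩
    exact hmark B hB
  · rintro _ ⟨_, ⟨d, hd, rfl⟩, rfl⟩
    exact hDfin.subset (hsubc d)
  · rintro _ ⟨_, ⟨d, hd, rfl⟩, rfl⟩
    exact linked_component
  · rintro _ ⟨_, ⟨d, hd, rfl⟩, rfl⟩ b hb
    exact hDmul b hb.1
  · rw [hDU, biUnion_image, biUnion_image]
    ext x
    simp only [mem_iUnion, exists_prop]
    constructor
    · intro hx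
      obtain ⟨d, hd, hx⟩ := mem_union.1 hx
      exact ⟨d, hd, mem_union.2 ⟨d, hcomp d hd, hx⟩⟩
    · rintro ⟨d, hd, hx⟩
      obtain ⟨b, hb, hx⟩ := mem_union.1 hx
      exact mem_union.2 ⟨b, hb.1, hx⟩
  · rintro _ ⟨_, ⟨d, hd, rfl⟩, rfl⟩ _ ⟨_, ⟨e, he, rfl⟩, rfl⟩ hne
    refine finite_inter_union (hDfin.subset (hsubc d)) (hDfin.subset (hsubc e)) ?_
    intro a ha b hb
    by_contra hinf
    refine hne ?_
    have : component K D d = component K D e := by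
      rw [component_eq ha.2, component_eq hb.2]
      exact component_eq (.single ⟨ha.1, hb.1, hinf⟩)
    rw [this]
  · refine ⟨s, ?_⟩
    rintro _ ⟨_, ⟨d, hd, rfl⟩, rfl⟩ b hb
    exact hDs b hb.1

/-! ### The tree of marked clusters -/

open Classical in
/-- A chosen splitting of `A` (empty if there is none). -/
noncomputable def splitting (F : Fin N → Similitude n) (K : Set (Euc n))
    (A : Set (Similitude n)) : Set (Node n) :=
  if h : ∃ C, IsSplitting F K A C then h.choose else ∅

/-- The children of a node: the chosen splitting of the normalized cluster, moved back. -/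
noncomputable def childSet (F : Fin N → Similitude n) (K : Set (Euc n)) (x : Node n) :
    Set (Node n) := x.2 • splitting F K (x.2⁻¹ • x.1)

/-- Similitudes carry splittings to splittings, so the choice can be made on the normalized cluster
`x.2⁻¹ • x.1` and moved back by `x.2`. -/
theorem isSplitting_childSet {x : Node n} (h : ∃ C, IsSplitting F K x.1 C) :
    IsSplitting F K x.1 (childSet F K x) := by
  obtain ⟨C, hC⟩ := h
  have h1 : ∃ C, IsSplitting F K (x.2⁻¹ • x.1) C := ⟨_, hC.smul _⟩
  have h2 : IsSplitting F K (x.2⁻¹ • x.1) (splitting F K (x.2⁻¹ • x.1)) := by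
    rw [splitting, dif_pos h1]
    exact h1.choose_spec
  have h3 := h2.smul x.2
  rwa [smul_inv_smul] at h3

/-- The node representing `K` itself. -/
noncomputable def rootNode (n : ℕ) : Node n := ({1}, 1)

/-- `y` is reached from `x` by passing to children. -/
def Reaches (F : Fin N → Similitude n) (K : Set (Euc n)) : Node n → Node n → Prop :=
  ReflTransGen fun x y => y ∈ childSet F K x

/-- A cluster with a mark in it. -/
def IsMarkedCluster (F : Fin N → Similitude n) (K : Set (Euc n)) (x : Node n) : Prop :=
  IsCluster F K x.1 ∧ x.2 ∈ x.1

theorem isMarkedCluster_rootNode (hK : IsSelfSimilarSet F K) :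
    IsMarkedCluster F K (rootNode n) := by
  refine ⟨⟨finite_singleton _, singleton_nonempty _, ?_, ?_, ?_⟩, mem_singleton _⟩
  · rintro _ rfl
    exact ⟨[], rfl⟩
  · rintro _ rfl _ rfl
    exact .refl
  · rintro _ rfl _ rfl
    rw [ratio_one, mul_one]
    exact minRatio_lt_one hK

theorem IsMarkedCluster.isSplitting
    (hsplit : ∀ A, IsCluster F K A → ∃ C, IsSplitting F K A C)
    {x : Node n} (hx : IsMarkedCluster F K x) :
    IsSplitting F K x.1 (childSet F K x) := isSplitting_childSet (hsplit _ hx.1)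

theorem IsMarkedCluster.child
    (hsplit : ∀ A, IsCluster F K A → ∃ C, IsSplitting F K A C)
    {x y : Node n} (hx : IsMarkedCluster F K x)
    (hy : y ∈ childSet F K x) : IsMarkedCluster F K y :=
  ⟨hx.1.of_isSplitting (hx.isSplitting hsplit) hy, (hx.isSplitting hsplit).mark_mem y hy⟩

theorem IsMarkedCluster.of_reaches
    (hsplit : ∀ A, IsCluster F K A → ∃ C, IsSplitting F K A C)
    {x y : Node n} (hx : IsMarkedCluster F K x)
    (hxy : Reaches F K x y) : IsMarkedCluster F K y := by
  induction hxy with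
  | refl => exact hx
  | tail _ h ih => exact ih.child hsplit h

theorem IsMarkedCluster.union_child_subset
    (hsplit : ∀ A, IsCluster F K A → ∃ C, IsSplitting F K A C)
    {x y : Node n} (hx : IsMarkedCluster F K x)
    (hy : y ∈ childSet F K x) : union K y.1 ⊆ union K x.1 := by
  rw [(hx.isSplitting hsplit).union_eq]
  exact subset_biUnion_of_mem (u := fun y : Node n => union K y.1) hy

theorem IsMarkedCluster.union_subset
    (hsplit : ∀ A, IsCluster F K A → ∃ C, IsSplitting F K A C)
    {x y : Node n} (hx : IsMarkedCluster F K x)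
    (hxy : Reaches F K x y) : union K y.1 ⊆ union K x.1 := by
  induction hxy with
  | refl => exact Subset.rfl
  | tail h1 h2 ih =>
    exact ((hx.of_reaches hsplit h1).union_child_subset hsplit h2).trans ih

theorem IsMarkedCluster.exists_ratio_le
    (hsplit : ∀ A, IsCluster F K A → ∃ C, IsSplitting F K A C)
    (hK : IsSelfSimilarSet F K) {x y : Node n}
    (hx : IsMarkedCluster F K x) (hxy : Reaches F K x y) {b : Similitude n} (hb : b ∈ y.1) :
    ∃ a ∈ x.1, Dilation.ratio b ≤ Dilation.ratio a := by
  induction hxy generalizing b with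
  | refl => exact ⟨b, hb, le_rfl⟩
  | tail h1 h2 ih =>
    obtain ⟨a, ha, v, rfl⟩ :=
      ((hx.of_reaches hsplit h1).isSplitting hsplit).exists_eq_mul _ h2 b hb
    obtain ⟨d, hd, had⟩ := ih ha
    refine ⟨d, hd, le_trans ?_ had⟩
    rw [ratio_mul, ratio_wordMap]
    exact mul_le_of_le_one_right' (wordRatio_le_one hK v)

/-- Otherwise the child would contain a sibling, whose infinite union would lie in their finite
intersection. -/
theorem IsMarkedCluster.union_child_ne
    (hsplit : ∀ A, IsCluster F K A → ∃ C, IsSplitting F K A C)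
    (hconn : IsConnected K) (hnt : K.Nontrivial) {x y : Node n}
    (hx : IsMarkedCluster F K x) (hy : y ∈ childSet F K x) : ¬ union K x.1 ⊆ union K y.1 := by
  intro hsub
  obtain ⟨z, hz, hzy⟩ := (hx.isSplitting hsplit).nontrivial.exists_ne y
  have h1 := (hx.isSplitting hsplit).finite_inter z hz y hy hzy
  rw [inter_eq_left.2 ((hx.union_child_subset hsplit hz).trans hsub)] at h1
  exact infinite_union hconn hnt (hx.child hsplit hz).1.nonempty h1

theorem IsMarkedCluster.eq_of_union_eq
    (hsplit : ∀ A, IsCluster F K A → ∃ C, IsSplitting F K A C)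
    (hconn : IsConnected K) (hnt : K.Nontrivial)
    {x y z : Node n} (hz : IsMarkedCluster F K z) (hx : Reaches F K z x) (hy : Reaches F K z y)
    (h : union K x.1 = union K y.1) : x = y := by
  induction hx using ReflTransGen.head_induction_on with
  | refl =>
    rcases ReflTransGen.cases_head hy with rfl | ⟨c, hc, hcy⟩
    · rfl
    · refine absurd ?_ (hz.union_child_ne hsplit hconn hnt hc)
      rw [h]
      exact (hz.child hsplit hc).union_subset hsplit hcy
  | @head z c hc hcx ih =>
    rcases ReflTransGen.cases_head hy with rfl | ⟨d, hd, hdy⟩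
    · refine absurd ?_ (hz.union_child_ne hsplit hconn hnt hc)
      rw [← h]
      exact (hz.child hsplit hc).union_subset hsplit hcx
    · by_cases hcd : c = d
      · subst hcd
        exact ih (hz.child hsplit hc) hdy
      · have h1 := (hz.isSplitting hsplit).finite_inter c hc d hd hcd
        have hxc := (hz.child hsplit hc).union_subset hsplit hcx
        have hyd := (hz.child hsplit hd).union_subset hsplit hdy
        refine absurd (h1.subset (subset_inter hxc (h ▸ hyd))) ?_
        exact infinite_union hconn hnt
          ((hz.child hsplit hc).of_reaches hsplit hcx).1.nonempty

/-- The nodes reached from the root. -/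
abbrev Vertex (F : Fin N → Similitude n) (K : Set (Euc n)) : Type :=
  {x : Node n // Reaches F K (rootNode n) x}

theorem union_rootNode : union K (rootNode n).1 = K := by simp [union, rootNode]

theorem countable_isMarkedCluster (F : Fin N → Similitude n) (K : Set (Euc n)) :
    {x : Node n | IsMarkedCluster F K x}.Countable := by
  have h1 : (range (wordMap F)).Countable := countable_range _
  refine ((Set.countable_ofPred_finite_subset h1).prod h1).mono ?_
  rintro x ⟨hx, hm⟩
  exact ⟨⟨hx.finite, hx.subset_range⟩, hx.subset_range hm⟩

theorem transGen_rootNode (x : Vertex F K) (hx : x.1 ≠ rootNode n) :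
    TransGen (fun a b : Vertex F K => b.1 ∈ childSet F K a.1) ⟨rootNode n, .refl⟩ x := by
  obtain ⟨x, hr⟩ := x
  have key : ReflTransGen (fun a b : Vertex F K => b.1 ∈ childSet F K a.1) ⟨rootNode n, .refl⟩
      ⟨x, hr⟩ := by
    clear hx
    induction hr with
    | refl => exact .refl
    | tail h1 h2 ih => exact ih.tail h2
  rcases reflTransGen_iff_eq_or_transGen.1 key with h | h
  · exact absurd (congrArg Subtype.val h) hx
  · exact h

/-! ### The nested structure and its types -/

/-- The points where `K` meets a neighboring copy in a finite set. -/
def touchingPoints (F : Fin N → Similitude n) (K : Set (Euc n)) : Set (Euc n) :=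
  ⋃ h ∈ {h | h ∈ neighborMaps F K ∧ (K ∩ h '' K).Finite}, K ∩ h '' K

theorem finite_touchingPoints (hH : (neighborMaps F K).Finite) : (touchingPoints F K).Finite :=
  (hH.subset fun _ h => h.1).biUnion fun _ h => h.2

theorem isMarkedCluster_vertex
    (hK : IsSelfSimilarSet F K)
    (hsplit : ∀ A, IsCluster F K A → ∃ C, IsSplitting F K A C)
    (x : Vertex F K) : IsMarkedCluster F K x.1 :=
  (isMarkedCluster_rootNode hK).of_reaches hsplit x.2

theorem finite_children
    (hK : IsSelfSimilarSet F K)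
    (hsplit : ∀ A, IsCluster F K A → ∃ C, IsSplitting F K A C)
    (x : Vertex F K) : {y : Vertex F K | y.1 ∈ childSet F K x.1}.Finite :=
  ((isMarkedCluster_vertex hK hsplit x).isSplitting hsplit).finite.preimage
    Subtype.val_injective.injOn

/-- The nested structure of unions of clusters. -/
noncomputable def nestedStructure
    (hK : IsSelfSimilarSet F K)
    (hsplit : ∀ A, IsCluster F K A → ∃ C, IsSplitting F K A C)
    (hconn : IsConnected K) (hnt : K.Nontrivial) :
    NestedStructure K (Vertex F K) where
  island x := union K x.1.1
  children x := (finite_children hK hsplit x).toFinset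
  root := ⟨rootNode n, .refl⟩
  countable := ((countable_isMarkedCluster F K).mono fun _ hx =>
    (isMarkedCluster_rootNode hK).of_reaches hsplit hx).to_subtype
  island_injective x y h := Subtype.ext <|
    (isMarkedCluster_rootNode hK).eq_of_union_eq hsplit hconn hnt x.2 y.2 h
  island_subset x := by
    have := (isMarkedCluster_rootNode hK).union_subset hsplit x.2
    rwa [union_rootNode] at this
  island_isCompact x := isCompact_union hK.isCompact (isMarkedCluster_vertex hK hsplit x).1.finite
  island_isConnected x := isConnected_union hconn (isMarkedCluster_vertex hK hsplit x).1.nonempty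
    (isMarkedCluster_vertex hK hsplit x).1.linked
  island_nontrivial x := nontrivial_union hnt (isMarkedCluster_vertex hK hsplit x).1.nonempty
  island_root := union_rootNode
  two_le_card_children x := by
    obtain ⟨y, hy, z, hz, hyz⟩ :=
      ((isMarkedCluster_vertex hK hsplit x).isSplitting hsplit).nontrivial
    refine Finset.one_lt_card.2 ⟨⟨y, x.2.tail hy⟩, ?_, ⟨z, x.2.tail hz⟩, ?_, ?_⟩
    · simpa using hy
    · simpa using hz
    · exact fun h => hyz (congrArg Subtype.val h)
  island_eq_iUnion x := by
    rw [((isMarkedCluster_vertex hK hsplit x).isSplitting hsplit).union_eq]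
    ext p
    simp only [mem_iUnion, Finite.mem_toFinset, mem_ofPred_eq, exists_prop]
    constructor
    · rintro ⟨y, hy, hp⟩
      exact ⟨⟨y, x.2.tail hy⟩, hy, hp⟩
    · rintro ⟨y, hy, hp⟩
      exact ⟨y.1, hy, hp⟩
  offspring_root x hx := by
    simpa using transGen_rootNode x fun h => hx (Subtype.ext h)

/-- Two vertices have the same type if they agree after normalizing the marks. -/
noncomputable def typeSystem
    (hK : IsSelfSimilarSet F K)
    (hsplit : ∀ A, IsCluster F K A → ∃ C, IsSplitting F K A C)
    (hconn : IsConnected K) (hnt : K.Nontrivial) :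
    (nestedStructure hK hsplit hconn hnt).TypeSystem where
  rel := Setoid.ker fun x : Vertex F K => x.1.2⁻¹ • x.1.1
  φ x y := y.1.2 * x.1.2⁻¹
  image_island x y h := by
    change _ '' union K x.1.1 = union K y.1.1
    have h : x.1.2⁻¹ • x.1.1 = y.1.2⁻¹ • y.1.1 := h
    rw [← union_smul, mul_smul, h, smul_inv_smul]
  φ_self x := mul_inv_cancel _
  φ_comp x z y _ _ := by group

/-! ### Finiteness of types and boundaries -/

/-- A point of a cluster that is shared with a sibling of one of its ancestors is a touching point
of one of the copies in the cluster. -/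
theorem exists_mem_touchingPoints
    (hK : IsSelfSimilarSet F K)
    (hsplit : ∀ A, IsCluster F K A → ∃ C, IsSplitting F K A C)
    {g d e : Node n} {y : Node n} (hg : IsMarkedCluster F K g)
    (hd : d ∈ childSet F K g) (he : e ∈ childSet F K g) (hne : d ≠ e) (hy : Reaches F K d y)
    {p : Euc n} (hpy : p ∈ union K y.1) (hpe : p ∈ union K e.1) :
    ∃ b ∈ y.1, p ∈ b '' touchingPoints F K := by
  have hS := hg.isSplitting hsplit
  obtain ⟨s, hs⟩ := hS.scale
  have hdM := hg.child hsplit hd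
  obtain ⟨b, hb, hpb⟩ := mem_union.1 hpy
  obtain ⟨a, ha, hpa⟩ := mem_union.1 hpe
  obtain ⟨b', hb', hbb'⟩ := hdM.exists_ratio_le hsplit hK hy hb
  have hsb : Dilation.ratio b ≤ s := hbb'.trans (hs d hd b' hb').2
  have hlt : minRatio F * Dilation.ratio b < Dilation.ratio a := by
    refine lt_of_le_of_lt ?_ (hs e he a ha).1
    gcongr
  -- The copy `a` in the sibling may be far larger than `b`; it is cut to the scale of `b` so that
  -- the piece containing the point is a neighbor of `b`.
  obtain ⟨T, -, hT, hTr⟩ := exists_cut hK (Dilation.ratio_pos b) hlt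
  obtain ⟨q, hq, rfl⟩ := hpa
  have hq' := hq
  rw [hT] at hq'
  obtain ⟨v, hv, hqv⟩ := mem_iUnion₂.1 hq'
  obtain ⟨h1, h2⟩ := hTr v hv
  rw [← ratio_wordMap, ← ratio_mul] at h1 h2
  have hpa : a q ∈ (a * wordMap F v) '' K := by
    rw [image_mul]; exact mem_image_of_mem _ hqv
  have hyM := hdM.of_reaches hsplit hy
  have hmem : b⁻¹ * (a * wordMap F v) ∈ neighborMaps F K := by
    refine mem_neighborMaps hK (hyM.1.subset_range hb)
      (mul_wordMap_mem_range ((hg.child hsplit he).1.subset_range ha) v) ⟨_, hpb, hpa⟩ h1 ?_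
    calc _ ≤ minRatio F * Dilation.ratio b := by gcongr
      _ < 1 * Dilation.ratio b := by
        have := Dilation.ratio_pos b
        gcongr
        exact minRatio_lt_one hK
      _ = _ := one_mul _
  have himg : b '' (K ∩ (b⁻¹ * (a * wordMap F v)) '' K) = b '' K ∩ (a * wordMap F v) '' K := by
    rw [image_inter, ← image_mul, mul_inv_cancel_left]
  -- Both copies stay inside the siblings `d` and `e`, whose intersection is finite.
  have hfin : (K ∩ (b⁻¹ * (a * wordMap F v)) '' K).Finite := by
    rw [← finite_image_iff b, himg]
    refine (hS.finite_inter d hd e he hne).subset (inter_subset_inter ?_ ?_)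
    · exact (image_subset_union hb).trans (hdM.union_subset hsplit hy)
    · rw [image_mul]
      exact (image_mono (cell_subset hK v)).trans (image_subset_union ha)
  refine ⟨b, hb, ?_⟩
  have hp : a q ∈ b '' (K ∩ (b⁻¹ * (a * wordMap F v)) '' K) := by
    rw [himg]; exact ⟨hpb, hpa⟩
  exact image_mono (subset_biUnion_of_mem
    (u := fun h : Similitude n => K ∩ h '' K)
    (show _ ∈ {h | h ∈ neighborMaps F K ∧ (K ∩ h '' K).Finite} from ⟨hmem, hfin⟩)) hp

/-- Of the two children of `g` sharing the point, at least one differs from the child `d` above `y`.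
-/
theorem exists_mem_touchingPoints_of_crossing
    (hK : IsSelfSimilarSet F K)
    (hsplit : ∀ A, IsCluster F K A → ∃ C, IsSplitting F K A C)
    (hconn : IsConnected K) (hnt : K.Nontrivial)
    {y g : Vertex F K} (hg : (nestedStructure hK hsplit hconn hnt).IsAncestor g y) {p : Euc n}
    (hp : p ∈ union K y.1.1) (hpg : p ∈ (nestedStructure hK hsplit hconn hnt).crossing g) :
    ∃ b ∈ y.1.1, p ∈ b '' touchingPoints F K := by
  have hmem : ∀ a b : Vertex F K, b ∈ (nestedStructure hK hsplit hconn hnt).children a ↔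
      b.1 ∈ childSet F K a.1 := fun a b => by simp [nestedStructure]
  obtain ⟨d, hd, hdy⟩ := TransGen.head'_iff.1 hg
  have hgM := isMarkedCluster_vertex hK hsplit g
  have hdy' : Reaches F K d.1 y.1 :=
    ReflTransGen.lift Subtype.val (fun a b h => (hmem a b).1 h) _ _ hdy
  obtain ⟨e, he, e', he', hee', hpe, hpe'⟩ := hpg
  rw [hmem] at hd he he'
  by_cases hde : d = e
  · subst hde
    exact exists_mem_touchingPoints hK hsplit hgM hd he' (fun h => hee' (Subtype.ext h)) hdy' hp
      hpe'
  · exact exists_mem_touchingPoints hK hsplit hgM hd he (fun h => hde (Subtype.ext h)) hdy' hp hpe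

theorem isFRFT_typeSystem
    (hK : IsSelfSimilarSet F K)
    (hsplit : ∀ A, IsCluster F K A → ∃ C, IsSplitting F K A C)
    (hconn : IsConnected K) (hnt : K.Nontrivial)
    (hH : (neighborMaps F K).Finite) {L : ℕ}
    (hL : ∀ (m : ℕ) (γ : Fin m → List (Fin N)),
      IsDeltaOverlappingChain F K (minRatio F) γ → m ≤ L) :
    (typeSystem hK hsplit hconn hnt).IsFRFT where
  finite_types := by
    have hfin : (range fun x : Vertex F K => x.1.2⁻¹ • x.1.1).Finite := by
      -- By rigidity every normalized cluster is a subset of the finite set `H^(L+2)`.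
      refine (finite_pow hH (L + 2)).finite_subsets.subset ?_
      rintro _ ⟨x, rfl⟩ _ ⟨a, ha, rfl⟩
      have hx := isMarkedCluster_vertex hK hsplit x
      exact hx.1.inv_mul_mem_pow hK hL hx.2 ha
    have := hfin.to_subtype
    exact Finite.of_equiv _ (Setoid.quotientKerEquivRange
      fun x : Vertex F K => x.1.2⁻¹ • x.1.1).symm
  same_splitting x x' hxx' := by
    have hrel : x.1.2⁻¹ • x.1.1 = x'.1.2⁻¹ • x'.1.1 := hxx'
    have hmem : ∀ a b : Vertex F K, b ∈ (nestedStructure hK hsplit hconn hnt).children a ↔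
        b.1 ∈ childSet F K a.1 := fun a b => by simp [nestedStructure]
    have hchild : ∀ a b : Vertex F K, a.1.2⁻¹ • a.1.1 = b.1.2⁻¹ • b.1.1 → ∀ y : Node n,
        y ∈ childSet F K a.1 → (b.1.2 * a.1.2⁻¹) • y ∈ childSet F K b.1 := by
      rintro a b hab _ ⟨y, hy, rfl⟩
      rw [hab] at hy
      refine ⟨y, hy, ?_⟩
      simp [mul_smul]
    refine ⟨⟨fun y => ⟨⟨(x'.1.2 * x.1.2⁻¹) • y.1.1, x'.2.tail
        (hchild x x' hrel y.1.1 ((hmem _ _).1 y.2))⟩, (hmem _ _).2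
        (hchild x x' hrel y.1.1 ((hmem _ _).1 y.2))⟩,
      fun y => ⟨⟨(x.1.2 * x'.1.2⁻¹) • y.1.1, x.2.tail
        (hchild x' x hrel.symm y.1.1 ((hmem _ _).1 y.2))⟩, (hmem _ _).2
        (hchild x' x hrel.symm y.1.1 ((hmem _ _).1 y.2))⟩, ?_, ?_⟩, ?_⟩
    · intro y
      refine Subtype.ext (Subtype.ext ?_)
      change (x.1.2 * x'.1.2⁻¹) • (x'.1.2 * x.1.2⁻¹) • y.1.1 = y.1.1
      simp [mul_smul]
    · intro y
      refine Subtype.ext (Subtype.ext ?_)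
      change (x'.1.2 * x.1.2⁻¹) • (x.1.2 * x'.1.2⁻¹) • y.1.1 = y.1.1
      simp [mul_smul]
    · intro y y'
      change _ ↔ y.1.1.2⁻¹ • y.1.1.1 = y'.1.1.2⁻¹ • y'.1.1.1 ∧
        y'.1.1.2 * y.1.1.2⁻¹ = x'.1.2 * x.1.2⁻¹
      rw [Subtype.ext_iff, Subtype.ext_iff]
      change y'.1.1 = (x'.1.2 * x.1.2⁻¹) • y.1.1 ↔ _
      constructor
      · intro h
        rw [h]
        simp [mul_smul, mul_assoc]
      -- The equality of similitudes fixes the mark of `y'`, and then the equality of normalized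
      -- clusters fixes its cluster.
      · rintro ⟨h1, h2⟩
        rw [← h2]
        refine Prod.ext ?_ ?_
        · rw [Prod.smul_fst, mul_smul, h1, smul_inv_smul]
        · simp
  finite_boundary x := by
    have hx := isMarkedCluster_vertex hK hsplit x
    have hfin : (⋃ a ∈ x.1.1, a '' touchingPoints F K).Finite :=
      hx.1.finite.biUnion fun a _ => (finite_touchingPoints hH).image a
    refine hfin.subset ?_
    refine iUnion₂_subset fun y hy => ?_
    rintro _ ⟨p, ⟨hpy, hpg⟩, rfl⟩
    obtain ⟨g, hg, hpg⟩ := mem_iUnion₂.1 hpg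
    have hrel : y.1.2⁻¹ • y.1.1 = x.1.2⁻¹ • x.1.1 := hy.1
    obtain ⟨b, hb, q, hq, rfl⟩ :=
      exists_mem_touchingPoints_of_crossing hK hsplit hconn hnt hg hpy hpg
    -- `φ` carries the cluster of `y` onto that of `x`, so one finite set serves all `y` of this
    -- type.
    refine mem_iUnion₂.2 ⟨x.1.2 * y.1.2⁻¹ * b, ?_, q, hq, rfl⟩
    have h1 : y.1.2⁻¹ • b ∈ x.1.2⁻¹ • x.1.1 := hrel ▸ smul_mem_smul_set hb
    rw [Set.mem_smul_set_iff_inv_smul_mem] at h1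
    simpa [mul_assoc] using h1

/-! ### From chain length properties to the bound on chains -/

/-- Since `δ ≤ c_*`, every `c_*`-overlapping chain is a `δ`-overlapping chain. -/
theorem FiniteDeltaChainLength.exists_bound {δ : ℝ≥0} (h : FiniteDeltaChainLength F K δ)
    (hδ : 0 < δ) (hδc : δ ≤ minRatio F) :
    ∃ L : ℕ, ∀ (m : ℕ) (γ : Fin m → List (Fin N)),
      IsDeltaOverlappingChain F K (minRatio F) γ → m ≤ L := by
  obtain ⟨L, hL⟩ := ENat.ne_top_iff_exists.1 (ne_of_lt h)
  refine ⟨L, fun m γ hγ => ?_⟩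
  have hγ' : IsDeltaOverlappingChain F K δ γ := ⟨hγ.1, fun i j =>
    ⟨hδc.trans (hγ.comparable i j).1, (hγ.comparable i j).2.trans (by gcongr)⟩⟩
  have : (m : ℕ∞) ≤ deltaChainLength F K δ := le_sSup ⟨m, γ, rfl, hγ'⟩
  rw [← hL] at this
  exact_mod_cast this

theorem FiniteChainLength.finiteDeltaChainLength (h : FiniteChainLength F K) (δ : ℝ≥0) :
    FiniteDeltaChainLength F K δ := by
  refine lt_of_le_of_lt (sSup_le_sSup ?_) h
  rintro _ ⟨m, γ, rfl, hγ⟩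
  exact ⟨m, γ, rfl, hγ.1⟩

theorem hasFRFTNestedStructure_of_finiteDeltaChainLength (hK : IsSelfSimilarSet F K)
    (hconn : IsConnected K) (hnt : K.Nontrivial) (hFNT : FiniteNeighboringType F K) {δ : ℝ≥0}
    (hδ : 0 < δ) (hδc : δ ≤ minRatio F) (h : FiniteDeltaChainLength F K δ) :
    HasFRFTNestedStructure K := by
  obtain ⟨L, hL⟩ := FiniteDeltaChainLength.exists_bound h hδ hδc
  have hsplit : ∀ A, IsCluster F K A → ∃ C, IsSplitting F K A C := fun A hA =>
    hA.exists_isSplitting hK hnt hFNT hL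
  exact ⟨_, _, _, isFRFT_typeSystem hK hsplit hconn hnt hFNT hL⟩

end SelfSimilar

theorem theorem3p8 {n N : ℕ} (F : Fin N → Similitude n) (K : Set (Euc n))
    (hK : IsSelfSimilarSet F K) (hconn : IsConnected K) (hnt : K.Nontrivial)
    (hFNT : FiniteNeighboringType F K) :
    ((∃ δ : ℝ≥0, 0 < δ ∧ δ ≤ minRatio F ∧ FiniteDeltaChainLength F K δ) →
        HasFRFTNestedStructure K) ∧
      (FiniteChainLength F K → HasFRFTNestedStructure K) := by
  refine ⟨fun ⟨δ, hδ, hδc, h⟩ => ?_, fun h => ?_⟩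
  · exact SelfSimilar.hasFRFTNestedStructure_of_finiteDeltaChainLength hK hconn hnt hFNT hδ hδc h
  · exact SelfSimilar.hasFRFTNestedStructure_of_finiteDeltaChainLength hK hconn hnt hFNT
      (SelfSimilar.minRatio_pos hK) le_rfl
      (SelfSimilar.FiniteChainLength.finiteDeltaChainLength h _)
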